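/- Throughout, a \emph{hyperbolic space} is a geodesic metric space $(S,d)$ (not necessarily proper) such that, for some $\delta\ge 0$, each side of every geodesic triangle in $S$ lies in the $\delta$-neighbourhood of the union of the other two sides. Its Gromov boundary $\partial S$ is the set of sequences $(x_i)$ in $S$ with $(x_i,x_j)_s\to\infty$ as $i,j\to\infty$, modulo the relation $(x_i)\sim(y_i)$ iff $(x_i,y_j)_s\to\infty$ as $i,j\to\infty$, where $(x,y)_s=\frac12\big(d(x,s)+d(y,s)-d(x,y)\big)$; these notions do not depend on $s\in S$. For a group $G$ acting on $S$ by isometries, the limit set $\Lambda(G)\subseteq\partial S$ is the set of limits in $\partial S$ of sequences of points of an orbit $Gs$ (it does not depend on $s$). The action is \emph{non-elementary} if $\Lambda(G)$ is infinite, and \emph{acylindrical} if for every $\varepsilon>0$ there exist $R,N>0$ such that for all $x,y\in S$ with $d(x,y)\ge R$ there are at most $N$ elements $g\in G$ with $d(x,gx)\le\varepsilon$ and $d(y,gy)\le\varepsilon$. A group is \emph{acylindrically hyperbolic} if it admits a non-elementary acylindrical isometric action on a hyperbolic space. Every acylindrically hyperbolic group $G$ has a unique maximal finite normal subgroup, denoted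 $K(G)$. Let $G$ be a countable acylindrically hyperbolic group acting ergodically by measure-preserving Borel transformations on a standard Borel probability space $(X,\nu)$. Then either the stabilizer $G_x=\{g\in G : gx=x\}$ is acylindrically hyperbolic for $\nu$-a.e. $x\in X$, or $G_x$ is finite for $\nu$-a.e. $x\in X$. If, in addition, $K(G)=1$, then in the latter case the action is essentially free, i.e. $G_x=1$ for $\nu$-a.e. $x\in X$. -/

import Mathlib

open Set Filter MeasureTheory

universe u v w

noncomputable section

namespace AcylHyp

section HyperbolicSpaces

variable {S : Type w} [MetricSpace S]

/-- `γ`, restricted to `[0, dist x y]`, is a geodesic from `x` to `y`. -/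
structure IsGeodesic (γ : ℝ → S) (x y : S) : Prop where
  source : γ 0 = x
  target : γ (dist x y) = y
  isom : ∀ s ∈ Icc (0 : ℝ) (dist x y), ∀ t ∈ Icc (0 : ℝ) (dist x y),
    dist (γ s) (γ t) = |s - t|

/-- Every side of every geodesic triangle lies in the closed `δ`-neighbourhood of the union of
the other two sides. (The vertices are arbitrary, so it suffices to name one side.) -/
def SlimTriangles (S : Type w) [MetricSpace S] (δ : ℝ) : Prop :=
  ∀ (x y z : S) (α β γ : ℝ → S), IsGeodesic α x y → IsGeodesic β y z → IsGeodesic γ x z →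
    ∀ s ∈ Icc (0 : ℝ) (dist x y),
      (∃ t ∈ Icc (0 : ℝ) (dist y z), dist (α s) (β t) ≤ δ) ∨
      (∃ t ∈ Icc (0 : ℝ) (dist x z), dist (α s) (γ t) ≤ δ)

/-- A hyperbolic space: a geodesic metric space, not necessarily proper, all of whose geodesic
triangles are `δ`-slim for some `δ ≥ 0`. -/
def IsHyperbolicSpace (S : Type w) [MetricSpace S] : Prop :=
  (∀ x y : S, ∃ γ : ℝ → S, IsGeodesic γ x y) ∧ ∃ δ : ℝ, 0 ≤ δ ∧ SlimTriangles S δ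

/-- The Gromov product `(x, y)_z`. -/
def gromovProduct (x y z : S) : ℝ :=
  (dist x z + dist y z - dist x y) / 2

/-- `(x_i, y_j)_s → ∞` as `i, j → ∞`. This does not depend on the base point `s`. -/
def SeqEquivalent (x y : ℕ → S) : Prop :=
  ∀ s : S, Tendsto (fun p : ℕ × ℕ => gromovProduct (x p.1) (y p.2) s) atTop atTop

/-- The sequence converges at infinity: `(x_i, x_j)_s → ∞` as `i, j → ∞`. -/
def ConvergesAtInfinity (x : ℕ → S) : Prop :=
  SeqEquivalent x x

/-- The Gromov boundary: sequences converging at infinity modulo equivalence. (In a hyperbolic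
space `SeqEquivalent` is an equivalence relation on these sequences.) -/
def GromovBoundary (S : Type w) [MetricSpace S] : Type w :=
  Quot (fun x y : {x : ℕ → S // ConvergesAtInfinity x} => SeqEquivalent x.1 y.1)

/-- The sequence `x` of points of `S` converges to the boundary point `ξ`. -/
def ConvergesTo (x : ℕ → S) (ξ : GromovBoundary S) : Prop :=
  ∃ h : ConvergesAtInfinity x, Quot.mk _ ⟨x, h⟩ = ξ

end HyperbolicSpaces

section Actions

variable (G : Type u) [Group G] (S : Type w) [MetricSpace S] [MulAction G S]

/-- The limit set `Λ(G) ⊆ ∂S`: all boundary points that are limits of sequences of points of an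
orbit `G s`; this does not depend on the choice of `s`. -/
def limitSet : Set (GromovBoundary S) :=
  {ξ | ∃ (s : S) (g : ℕ → G), ConvergesTo (fun i => g i • s) ξ}

/-- The action is non-elementary: its limit set is infinite. -/
def IsNonElementaryAction : Prop :=
  (limitSet G S).Infinite

/-- The action is acylindrical. -/
def IsAcylindricalAction : Prop :=
  ∀ ε : ℝ, 0 < ε → ∃ R : ℝ, 0 < R ∧ ∃ N : ℕ, 0 < N ∧ ∀ x y : S, R ≤ dist x y →
    {g : G | dist x (g • x) ≤ ε ∧ dist y (g • y) ≤ ε}.encard ≤ N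

end Actions

/-- `G` is acylindrically hyperbolic: it admits a non-elementary acylindrical isometric action on
a hyperbolic space. -/
def IsAcylindricallyHyperbolic (G : Type u) [Group G] : Prop :=
  ∃ (S : Type w) (_ : MetricSpace S) (_ : MulAction G S) (_ : IsIsometricSMul G S),
    IsHyperbolicSpace S ∧ IsAcylindricalAction G S ∧ IsNonElementaryAction G S

/-- `K(G)`: the subgroup generated by all finite normal subgroups of `G`. Whenever `G` has a
largest finite normal subgroup, as acylindrically hyperbolic groups do, `K(G)` is that subgroup. -/
def finiteRadical (G : Type u) [Group G] : Subgroup G :=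
  sSup {N : Subgroup G | N.Normal ∧ Finite N}

/-- The action is essentially free: almost every point has trivial stabilizer. -/
def IsEssentiallyFree (G : Type u) [Group G] {X : Type v} [MeasurableSpace X] [MulAction G X]
    (ν : Measure X) : Prop :=
  ∀ᵐ x ∂ν, MulAction.stabilizer G x = ⊥

end AcylHyp

end

/-!
By Poincaré recurrence, almost every stabilizer `H` has the following property: for all `h ∈ H` and
`g ∈ G`, the conjugate `gⁿ h g⁻ⁿ` lies in `H` for infinitely many `n`. Let `H` be an infinite
subgroup with this property and let `g` be loxodromic with attracting point `ξ` and repelling point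
`η`. If some `h ∈ H` moves `ξ`, then by acylindricity it also moves `η`, so that `gⁿ h g⁻ⁿ s`
converges to `ξ`, because `h g⁻ⁿ s` tends to `h η ≠ η`, hence stays in a different direction from
`g⁻ⁿ s`. Thus `ξ ∈ Λ(H)`. The loxodromic elements of `G` have infinitely many attracting points, and
at most two of them are fixed by all of `H`, since by acylindricity only finitely many elements
fix `ξ`, `η` and a third boundary point. So `Λ(H)` is infinite.

If a finite subgroup `F` is the stabilizer of a set of points of positive measure, then so is each
of its conjugates, for disjoint sets of the same measure. Hence `F` has finitely many conjugates,
and by Dietzmann's lemma they generate a finite normal subgroup.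
-/

namespace AcylHyp

section FourPoint

variable {S : Type w} [MetricSpace S]

theorem gromovProduct_comm (x y z : S) : gromovProduct x y z = gromovProduct y x z := by
  simp only [gromovProduct, dist_comm x y, add_comm]

theorem gromovProduct_nonneg (x y z : S) : 0 ≤ gromovProduct x y z := by
  rw [gromovProduct]
  linarith [dist_triangle_right x y z]

theorem gromovProduct_base_left (x z : S) : gromovProduct z x z = 0 := by
  simp [gromovProduct, dist_comm]

theorem gromovProduct_base_right (x z : S) : gromovProduct x z z = 0 := by
  rw [gromovProduct_comm, gromovProduct_base_left]

theorem gromovProduct_eq_dist_sub (x y z : S) :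
    gromovProduct x y z = dist z x - gromovProduct z y x := by
  simp only [gromovProduct, dist_comm x z, dist_comm y z, dist_comm y x]
  ring

theorem gromovProduct_le_dist_left (x y z : S) : gromovProduct x y z ≤ dist z x := by
  rw [gromovProduct_eq_dist_sub]
  linarith [gromovProduct_nonneg z y x]

theorem gromovProduct_le_add_dist_left (x x' y z : S) :
    gromovProduct x y z ≤ gromovProduct x' y z + dist x x' := by
  simp only [gromovProduct]
  linarith [dist_triangle x x' z, dist_triangle_left x' y x]

theorem gromovProduct_le_add_dist_right (x y y' z : S) :
    gromovProduct x y z ≤ gromovProduct x y' z + dist y y' := by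
  rw [gromovProduct_comm x y, gromovProduct_comm x y']
  exact gromovProduct_le_add_dist_left y y' x z

theorem gromovProduct_le_add_dist_base (x y z z' : S) :
    gromovProduct x y z ≤ gromovProduct x y z' + dist z z' := by
  simp only [gromovProduct]
  linarith [dist_triangle_right x z z', dist_triangle_right y z z']

namespace IsGeodesic

variable {γ : ℝ → S} {x y : S}

theorem dist_source (hγ : IsGeodesic γ x y) {t : ℝ} (ht : t ∈ Icc 0 (dist x y)) :
    dist x (γ t) = t := by
  simpa [hγ.source, abs_of_nonneg ht.1] using hγ.isom 0 ⟨le_rfl, dist_nonneg⟩ t ht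

theorem dist_target (hγ : IsGeodesic γ x y) {t : ℝ} (ht : t ∈ Icc 0 (dist x y)) :
    dist (γ t) y = dist x y - t := by
  have h := hγ.isom t ht _ ⟨dist_nonneg, le_rfl⟩
  rwa [hγ.target, abs_sub_comm, abs_of_nonneg (sub_nonneg.2 ht.2)] at h

theorem gromovProduct_le_dist (hγ : IsGeodesic γ x y) {t : ℝ} (ht : t ∈ Icc 0 (dist x y)) (z : S) :
    gromovProduct x y z ≤ dist z (γ t) := by
  rw [gromovProduct, dist_comm z]
  linarith [dist_triangle x (γ t) z, dist_triangle_left y z (γ t), hγ.dist_source ht,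
    hγ.dist_target ht]

theorem exists_dist_le_gromovProduct_add {δ : ℝ} (hδ : SlimTriangles S δ)
    (hS : ∀ x y : S, ∃ γ : ℝ → S, IsGeodesic γ x y) (hγ : IsGeodesic γ x y) (z : S) :
    ∃ t ∈ Icc (0 : ℝ) (dist x y), dist z (γ t) ≤ gromovProduct x y z + 2 * δ := by
  obtain ⟨β, hβ⟩ := hS y z
  obtain ⟨α, hα⟩ := hS x z
  -- the point where the inscribed circle of a comparison triangle touches the side `γ`
  have ht : gromovProduct y z x ∈ Icc 0 (dist x y) :=
    ⟨gromovProduct_nonneg y z x, gromovProduct_le_dist_left y z x⟩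
  refine ⟨_, ht, ?_⟩
  have hx := hγ.dist_source ht
  have hy := hγ.dist_target ht
  have hz : gromovProduct x y z = dist x z - gromovProduct y z x := by
    rw [gromovProduct_eq_dist_sub, gromovProduct_comm, dist_comm]
  rw [dist_comm z]
  rcases hδ x y z γ β α hγ hβ hα _ ht with ⟨s, hs, hd⟩ | ⟨s, hs, hd⟩
  · have hyz : gromovProduct y z x = (dist x y + dist x z - dist y z) / 2 := by
      rw [gromovProduct, dist_comm y x, dist_comm z x]
    linarith [hβ.dist_source hs, hβ.dist_target hs, dist_triangle (γ (gromovProduct y z x)) (β s) z,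
      dist_triangle_right (γ (gromovProduct y z x)) y (β s)]
  · linarith [hα.dist_source hs, hα.dist_target hs, dist_triangle (γ (gromovProduct y z x)) (α s) z,
      dist_triangle_right x (γ (gromovProduct y z x)) (α s)]

end IsGeodesic

/-- Gromov's four-point condition, the form of hyperbolicity in which Gromov products of points
and of boundary points can be compared. -/
def FourPoint (S : Type w) [MetricSpace S] (δ : ℝ) : Prop :=
  ∀ x y z o : S, min (gromovProduct x y o) (gromovProduct y z o) ≤ gromovProduct x z o + δ

theorem IsHyperbolicSpace.exists_fourPoint (hS : IsHyperbolicSpace S) : ∃ δ, FourPoint S δ := by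
  obtain ⟨hgeo, δ, -, hδ⟩ := hS
  refine ⟨3 * δ, fun x y z o => ?_⟩
  obtain ⟨α, hα⟩ := hgeo x z
  obtain ⟨β, hβ⟩ := hgeo z y
  obtain ⟨γ, hγ⟩ := hgeo x y
  obtain ⟨s, hs, hos⟩ := hα.exists_dist_le_gromovProduct_add hδ hgeo o
  rcases hδ x z y α β γ hα hβ hγ s hs with ⟨t, ht, hst⟩ | ⟨t, ht, hst⟩
  · refine (min_le_right _ _).trans ?_
    rw [gromovProduct_comm]
    linarith [hβ.gromovProduct_le_dist ht o, dist_triangle o (α s) (β t)]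
  · refine (min_le_left _ _).trans ?_
    linarith [hγ.gromovProduct_le_dist ht o, dist_triangle o (α s) (γ t)]

namespace FourPoint

variable {δ C : ℝ} {x y z x' z' o p q : S}

theorem nonneg (hS : FourPoint S δ) (o : S) : 0 ≤ δ := by
  simpa [gromovProduct] using hS o o o o

theorem le_gromovProduct_add (hS : FourPoint S δ) (hxy : C ≤ gromovProduct x y o)
    (hyz : C ≤ gromovProduct y z o) : C ≤ gromovProduct x z o + δ :=
  (le_min hxy hyz).trans (hS x y z o)

theorem gromovProduct_le_of_lt (hS : FourPoint S δ) (hxz : gromovProduct x z o ≤ C)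
    (hxy : C + δ < gromovProduct x y o) : gromovProduct y z o ≤ C + δ := by
  rcases min_le_iff.1 (hS x y z o) with h | h <;> linarith

theorem gromovProduct_le_of_lt_of_lt (hS : FourPoint S δ) (hxz : gromovProduct x z o ≤ C)
    (hx : C + 2 * δ < gromovProduct x x' o) (hz : C + 2 * δ < gromovProduct z z' o) :
    gromovProduct x' z' o ≤ C + 2 * δ := by
  have hδ := hS.nonneg o
  have hx'z : gromovProduct x' z o ≤ C + δ := hS.gromovProduct_le_of_lt hxz (by linarith)
  rw [gromovProduct_comm] at hx'z ⊢
  linarith [hS.gromovProduct_le_of_lt hx'z (y := z') (by linarith)]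

/-- Two of the three products `(x, q)_p`, `(y, q)_p`, `(z, q)_p` are small, and likewise with `p`
and `q` exchanged, so one of `x`, `y`, `z` serves both sides of `(a, q)_p + (a, p)_q = d(p, q)`. -/
theorem dist_le_of_gromovProduct_le (hS : FourPoint S δ)
    (hp₁ : gromovProduct x y p ≤ C) (hp₂ : gromovProduct y z p ≤ C) (hp₃ : gromovProduct x z p ≤ C)
    (hq₁ : gromovProduct x y q ≤ C) (hq₂ : gromovProduct y z q ≤ C)
    (hq₃ : gromovProduct x z q ≤ C) : dist p q ≤ 2 * (C + δ) := by
  have small : ∀ {a b o : S} (c : S), gromovProduct a b o ≤ C →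
      gromovProduct a c o ≤ C + δ ∨ gromovProduct b c o ≤ C + δ := fun {a b o} c h => by
    rw [gromovProduct_comm b c]
    exact min_le_iff.1 ((hS a c b o).trans (by linarith))
  have close : ∀ a, gromovProduct a q p ≤ C + δ → gromovProduct a p q ≤ C + δ →
      dist p q ≤ 2 * (C + δ) := fun a hap haq => by
    rw [gromovProduct_comm, gromovProduct_eq_dist_sub, gromovProduct_comm] at hap
    linarith
  have hx := close x
  have hy := close y
  have hz := close z
  have hp := And.intro (small q hp₁) (And.intro (small q hp₂) (small q hp₃))
  have hq := And.intro (small p hq₁) (And.intro (small p hq₂) (small p hq₃))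
  tauto

end FourPoint

end FourPoint

section Boundary

variable {S : Type w} [MetricSpace S]

theorem seqEquivalent_iff (o : S) {x y : ℕ → S} : SeqEquivalent x y ↔
    ∀ M, ∃ N, ∀ i ≥ N, ∀ j ≥ N, M ≤ gromovProduct (x i) (y j) o := by
  constructor
  · intro h M
    obtain ⟨⟨a, b⟩, hab⟩ := eventually_atTop.1 ((h o).eventually_ge_atTop M)
    exact ⟨max a b, fun i hi j hj => hab (i, j) ⟨le_of_max_le_left hi, le_of_max_le_right hj⟩⟩
  · intro h s
    refine tendsto_atTop.2 fun M => ?_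
    obtain ⟨N, hN⟩ := h (M + dist o s)
    filter_upwards [eventually_ge_atTop (N, N)] with p hp
    linarith [hN p.1 hp.1 p.2 hp.2, gromovProduct_le_add_dist_base (x p.1) (y p.2) o s]

namespace SeqEquivalent

variable {x y : ℕ → S}

theorem symm (h : SeqEquivalent x y) : SeqEquivalent y x := by
  refine fun o => (seqEquivalent_iff o).2 (fun M => ?_) o
  obtain ⟨N, hN⟩ := (seqEquivalent_iff o).1 h M
  exact ⟨N, fun i hi j hj => (hN j hj i hi).trans_eq (gromovProduct_comm _ _ _)⟩

theorem trans {δ : ℝ} (hS : FourPoint S δ) {z : ℕ → S} (hxy : SeqEquivalent x y)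
    (hyz : SeqEquivalent y z) : SeqEquivalent x z := by
  refine fun o => (seqEquivalent_iff o).2 (fun M => ?_) o
  obtain ⟨N, hN⟩ := (seqEquivalent_iff o).1 hxy (M + δ)
  obtain ⟨N', hN'⟩ := (seqEquivalent_iff o).1 hyz (M + δ)
  refine ⟨max N N', fun i hi j hj => ?_⟩
  have hx := hN i (le_of_max_le_left hi) (max N N') (le_max_left _ _)
  have hz := hN' (max N N') (le_max_right _ _) j (le_of_max_le_right hj)
  linarith [hS.le_gromovProduct_add hx hz]

theorem comp_left (h : SeqEquivalent x y) {φ : ℕ → ℕ} (hφ : Tendsto φ atTop atTop) :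
    SeqEquivalent (x ∘ φ) y := by
  refine fun o => (seqEquivalent_iff o).2 (fun M => ?_) o
  obtain ⟨N, hN⟩ := (seqEquivalent_iff o).1 h M
  obtain ⟨N', hN'⟩ := eventually_atTop.1 (hφ.eventually_ge_atTop N)
  exact ⟨max N N', fun i hi j hj =>
    hN _ (hN' i (le_of_max_le_right hi)) j (le_of_max_le_left hj)⟩

theorem of_dist_le (h : SeqEquivalent x y) {y' : ℕ → S} {D : ℝ}
    (hD : ∀ n, dist (y n) (y' n) ≤ D) : SeqEquivalent x y' := by
  refine fun o => tendsto_atTop_mono (fun p => ?_) (tendsto_atTop_add_const_right _ (-D) (h o))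
  linarith [gromovProduct_le_add_dist_right (x p.1) (y p.2) (y' p.2) o, hD p.2]

theorem tendsto_diagonal (h : SeqEquivalent x y) (o : S) :
    Tendsto (fun n => gromovProduct (x n) (y n) o) atTop atTop :=
  (h o).comp tendsto_atTop_diagonal

end SeqEquivalent

theorem FourPoint.mk_eq_mk_iff {δ : ℝ} (hS : FourPoint S δ)
    {x y : {x : ℕ → S // ConvergesAtInfinity x}} :
    (Quot.mk _ x : GromovBoundary S) = Quot.mk _ y ↔ SeqEquivalent x.1 y.1 := by
  have hequiv : Equivalence fun x y : {x : ℕ → S // ConvergesAtInfinity x} =>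
      SeqEquivalent x.1 y.1 := ⟨fun x => x.2, .symm, .trans hS⟩
  exact hequiv.quot_mk_eq_iff x y

theorem nonempty_of_gromovBoundary (ξ : GromovBoundary S) : Nonempty S := by
  obtain ⟨x, -⟩ := Quot.exists_rep ξ
  exact ⟨x.1 0⟩

theorem exists_convergesTo (ξ : GromovBoundary S) :
    ∃ x : ℕ → S, ConvergesTo x ξ := by
  obtain ⟨x, rfl⟩ := Quot.exists_rep ξ
  exact ⟨x.1, x.2, rfl⟩

namespace ConvergesTo

variable {δ : ℝ} {x y : ℕ → S} {ξ η : GromovBoundary S}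

theorem eq_iff_seqEquivalent (hS : FourPoint S δ) (hx : ConvergesTo x ξ) (hy : ConvergesTo y η) :
    ξ = η ↔ SeqEquivalent x y := by
  obtain ⟨_, rfl⟩ := hx
  obtain ⟨_, rfl⟩ := hy
  exact hS.mk_eq_mk_iff

theorem of_seqEquivalent (hS : FourPoint S δ) (hx : ConvergesTo x ξ) (hxy : SeqEquivalent x y) :
    ConvergesTo y ξ := by
  obtain ⟨_, rfl⟩ := hx
  exact ⟨hxy.symm.trans hS hxy, Quot.sound hxy.symm⟩

theorem of_dist_le (hx : ConvergesTo x ξ) {D : ℝ} (hD : ∀ n, dist (x n) (y n) ≤ D) :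
    ConvergesTo y ξ := by
  obtain ⟨h, rfl⟩ := hx
  have hxy : SeqEquivalent x y := h.of_dist_le hD
  exact ⟨hxy.symm.of_dist_le hD, Quot.sound hxy.symm⟩

theorem comp (hx : ConvergesTo x ξ) {φ : ℕ → ℕ} (hφ : Tendsto φ atTop atTop) :
    ConvergesTo (x ∘ φ) ξ := by
  obtain ⟨h, rfl⟩ := hx
  have hφx : SeqEquivalent (x ∘ φ) x := h.comp_left hφ
  exact ⟨hφx.symm.comp_left hφ, Quot.sound hφx⟩

theorem unique (hS : FourPoint S δ) (hξ : ConvergesTo x ξ) (hη : ConvergesTo x η) : ξ = η :=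
  (hξ.eq_iff_seqEquivalent hS hη).2 hξ.1

theorem tendsto_dist (hx : ConvergesTo x ξ) (o : S) :
    Tendsto (fun n => dist o (x n)) atTop atTop :=
  tendsto_atTop_mono (fun _ => gromovProduct_le_dist_left _ _ _) (hx.1.tendsto_diagonal o)

theorem of_tendsto_gromovProduct (hS : FourPoint S δ) (hx : ConvergesTo x ξ) (o : S)
    (hxy : Tendsto (fun n => gromovProduct (x n) (y n) o) atTop atTop) : ConvergesTo y ξ := by
  refine hx.of_seqEquivalent hS ((seqEquivalent_iff o).2 fun M => ?_)
  obtain ⟨N, hN⟩ := (seqEquivalent_iff o).1 hx.1 (M + δ)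
  obtain ⟨N', hN'⟩ := eventually_atTop.1 (hxy.eventually_ge_atTop (M + δ))
  refine ⟨max N N', fun i hi j hj => ?_⟩
  have hxx := hN i (le_of_max_le_left hi) j (le_of_max_le_left hj)
  linarith [hS.le_gromovProduct_add hxx (hN' j (le_of_max_le_right hj))]

theorem exists_eventually_gromovProduct_le (hS : FourPoint S δ) (hx : ConvergesTo x ξ)
    (hy : ConvergesTo y η) (hne : ξ ≠ η) (o : S) :
    ∃ C, ∀ᶠ p : ℕ × ℕ in atTop, gromovProduct (x p.1) (y p.2) o ≤ C := by
  rw [Ne, hx.eq_iff_seqEquivalent hS hy, seqEquivalent_iff o] at hne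
  push Not at hne
  obtain ⟨M, hM⟩ := hne
  obtain ⟨N, hN⟩ := (seqEquivalent_iff o).1 hx.1 (M + 2 * δ + 1)
  obtain ⟨N', hN'⟩ := (seqEquivalent_iff o).1 hy.1 (M + 2 * δ + 1)
  obtain ⟨i, hi, j, hj, hij⟩ := hM (max N N')
  refine ⟨M + 2 * δ, ?_⟩
  filter_upwards [eventually_ge_atTop (N, N')] with p hp
  exact hS.gromovProduct_le_of_lt_of_lt hij.le
    (by linarith [hN i (le_of_max_le_left hi) p.1 hp.1])
    (by linarith [hN' j (le_of_max_le_right hj) p.2 hp.2])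

end ConvergesTo

end Boundary

section BoundaryAction

variable {G : Type u} [Group G] {S : Type w} [MetricSpace S] [MulAction G S] [IsIsometricSMul G S]

theorem gromovProduct_smul (g : G) (x y z : S) :
    gromovProduct (g • x) (g • y) (g • z) = gromovProduct x y z := by
  simp only [gromovProduct, dist_smul]

theorem SeqEquivalent.smul (g : G) {x y : ℕ → S} (h : SeqEquivalent x y) :
    SeqEquivalent (fun n => g • x n) (fun n => g • y n) := by
  intro o
  have hg : ∀ p : ℕ × ℕ, gromovProduct (g • x p.1) (g • y p.2) o =
      gromovProduct (x p.1) (y p.2) (g⁻¹ • o) := fun p => by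
    rw [← gromovProduct_smul g (x p.1), smul_inv_smul]
  simpa only [hg] using h (g⁻¹ • o)

instance : MulAction G (GromovBoundary S) where
  smul g := Quot.map (fun x => ⟨fun n => g • x.1 n, x.2.smul g⟩) fun _ _ => SeqEquivalent.smul g
  one_smul ξ := by
    induction ξ using Quot.inductionOn with
    | h x => exact congrArg (Quot.mk _) (Subtype.ext (funext fun n => one_smul G (x.1 n)))
  mul_smul a b ξ := by
    induction ξ using Quot.inductionOn with
    | h x => exact congrArg (Quot.mk _) (Subtype.ext (funext fun n => mul_smul a b (x.1 n)))

theorem ConvergesTo.smul (g : G) {x : ℕ → S} {ξ : GromovBoundary S} (hx : ConvergesTo x ξ) :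
    ConvergesTo (fun n => g • x n) (g • ξ) := by
  obtain ⟨h, rfl⟩ := hx
  exact ⟨h.smul g, rfl⟩

theorem exists_dist_smul_le_of_fixed {δ : ℝ} (hS : FourPoint S δ) {ξ η ζ : GromovBoundary S}
    (hξη : ξ ≠ η) (hηζ : η ≠ ζ) (hξζ : ξ ≠ ζ) (o : S) :
    ∃ K, ∀ g : G, g • ξ = ξ → g • η = η → g • ζ = ζ → dist o (g • o) ≤ K := by
  obtain ⟨x, hx⟩ := exists_convergesTo ξ
  obtain ⟨y, hy⟩ := exists_convergesTo η
  obtain ⟨z, hz⟩ := exists_convergesTo ζ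
  obtain ⟨C₁, hxy⟩ := hx.exists_eventually_gromovProduct_le hS hy hξη o
  obtain ⟨C₂, hyz⟩ := hy.exists_eventually_gromovProduct_le hS hz hηζ o
  obtain ⟨C₃, hxz⟩ := hx.exists_eventually_gromovProduct_le hS hz hξζ o
  set C := max C₁ (max C₂ C₃)
  have hC₁ : C₁ ≤ C := le_max_left _ _
  have hC₂ : C₂ ≤ C := (le_max_left _ _).trans (le_max_right _ _)
  have hC₃ : C₃ ≤ C := (le_max_right _ _).trans (le_max_right _ _)
  have hδ := hS.nonneg o
  refine ⟨2 * (C + 2 * δ + δ), fun g hgξ hgη hgζ => ?_⟩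
  have close : ∀ {ω : GromovBoundary S} {a : ℕ → S}, ConvergesTo a ω → g • ω = ω →
      ∀ᶠ n in atTop, C + 2 * δ < gromovProduct (g • a n) (a n) (g • o) := fun ha hω =>
    ((((ha.smul g).eq_iff_seqEquivalent hS ha).1 hω).tendsto_diagonal (g • o)).eventually_gt_atTop _
  have hdiag := tendsto_atTop_diagonal (α := ℕ)
  obtain ⟨n, hxn, hyn, hzn, hxyn, hyzn, hxzn⟩ := ((close hx hgξ).and ((close hy hgη).and
    ((close hz hgζ).and ((hdiag.eventually hxy).and ((hdiag.eventually hyz).and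
      (hdiag.eventually hxz)))))).exists
  have move : ∀ {a b : S}, gromovProduct a b o ≤ C →
      C + 2 * δ < gromovProduct (g • a) a (g • o) → C + 2 * δ < gromovProduct (g • b) b (g • o) →
      gromovProduct a b (g • o) ≤ C + 2 * δ := fun h =>
    hS.gromovProduct_le_of_lt_of_lt ((gromovProduct_smul g _ _ _).trans_le h)
  exact hS.dist_le_of_gromovProduct_le (x := x n) (y := y n) (z := z n) (by linarith) (by linarith)
    (by linarith) (move (by linarith) hxn hyn) (move (by linarith) hyn hzn)
    (move (by linarith) hxn hzn)

end BoundaryAction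

section Loxodromic

variable {G : Type u} [Group G] {S : Type w} [MetricSpace S] [MulAction G S]

/-- `g` acts loxodromically on `S`: its forward and backward orbits converge to two distinct
boundary points, the attracting point `ξ` and the repelling point `η`. Carrying the two points in
the predicate avoids choosing them. -/
structure IsLoxodromic (g : G) (ξ η : GromovBoundary S) : Prop where
  attracting : ∀ o : S, ConvergesTo (fun n : ℕ => g ^ n • o) ξ
  repelling : ∀ o : S, ConvergesTo (fun n : ℕ => g⁻¹ ^ n • o) η
  ne : ξ ≠ η

variable {δ C : ℝ} {g h : G} {o : S} {ξ η ζ : GromovBoundary S}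

theorem IsLoxodromic.inv (hg : IsLoxodromic g ξ η) : IsLoxodromic g⁻¹ η ξ :=
  ⟨hg.repelling, by simpa only [inv_inv] using hg.attracting, hg.ne.symm⟩

variable [IsIsometricSMul G S]

theorem dist_inv_smul_left (g : G) (x y : S) : dist (g⁻¹ • x) y = dist x (g • y) := by
  rw [← dist_smul g, smul_inv_smul]

theorem dist_inv_smul_self (g : G) (o : S) : dist o (g⁻¹ • o) = dist o (g • o) := by
  rw [dist_comm, dist_inv_smul_left]

theorem gromovProduct_smul_mul_smul (a b : G) (o : S) :
    gromovProduct (a • o) ((a * b) • o) o = dist o (a • o) - gromovProduct (a⁻¹ • o) (b • o) o := by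
  rw [gromovProduct_eq_dist_sub, ← gromovProduct_smul a⁻¹ o, inv_smul_smul, smul_smul,
    inv_mul_cancel_left]

theorem dist_sub_le_gromovProduct_pow_smul
    (hC : ∀ m n : ℕ, gromovProduct (g⁻¹ ^ m • o) (g ^ n • o) o ≤ C) {i j : ℕ} (hij : i ≤ j) :
    dist o (g ^ i • o) - C ≤ gromovProduct (g ^ i • o) (g ^ j • o) o := by
  have h := gromovProduct_smul_mul_smul (g ^ i) (g ^ (j - i)) o
  rw [← pow_add, Nat.add_sub_cancel' hij, ← inv_pow] at h
  linarith [hC i (j - i)]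

theorem convergesAtInfinity_pow_smul
    (hC : ∀ m n : ℕ, gromovProduct (g⁻¹ ^ m • o) (g ^ n • o) o ≤ C)
    (hg : Tendsto (fun n : ℕ => dist o (g ^ n • o)) atTop atTop) :
    ConvergesAtInfinity (fun n : ℕ => g ^ n • o) := by
  refine (seqEquivalent_iff o).2 fun M => ?_
  obtain ⟨N, hN⟩ := eventually_atTop.1 (hg.eventually_ge_atTop (M + C))
  refine ⟨N, fun i hi j hj => ?_⟩
  rcases le_total i j with hij | hji
  · linarith [dist_sub_le_gromovProduct_pow_smul hC hij, hN i hi]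
  · rw [gromovProduct_comm]
    linarith [dist_sub_le_gromovProduct_pow_smul hC hji, hN j hj]

section LargeDisplacement

theorem gromovProduct_inv_smul_pow_smul_le (hS : FourPoint S δ)
    (hC : gromovProduct (g⁻¹ • o) (g • o) o ≤ C) (hg : 2 * C + 4 * δ + 1 ≤ dist o (g • o))
    (n : ℕ) : gromovProduct (g⁻¹ • o) (g ^ n • o) o ≤ C + δ := by
  have hδ := hS.nonneg o
  have hC₀ := (gromovProduct_nonneg _ _ _).trans hC
  induction n with
  | zero =>
    rw [pow_zero, one_smul, gromovProduct_base_right]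
    positivity
  | succ n ih =>
    rw [gromovProduct_comm] at hC ⊢
    refine hS.gromovProduct_le_of_lt hC ?_
    rw [pow_succ', gromovProduct_smul_mul_smul]
    linarith

theorem lt_gromovProduct_smul_pow_succ_smul (hS : FourPoint S δ)
    (hC : gromovProduct (g⁻¹ • o) (g • o) o ≤ C) (hg : 2 * C + 4 * δ + 1 ≤ dist o (g • o))
    (n : ℕ) : C + 2 * δ < gromovProduct (g • o) (g ^ (n + 1) • o) o := by
  rw [pow_succ', gromovProduct_smul_mul_smul]
  linarith [gromovProduct_inv_smul_pow_smul_le hS hC hg n, hS.nonneg o]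

theorem natCast_le_dist_pow_smul (hS : FourPoint S δ)
    (hC : gromovProduct (g⁻¹ • o) (g • o) o ≤ C) (hg : 2 * C + 4 * δ + 1 ≤ dist o (g • o))
    (n : ℕ) : (n : ℝ) ≤ dist o (g ^ n • o) := by
  induction n with
  | zero => simp
  | succ n ih =>
    have hprod := gromovProduct_inv_smul_pow_smul_le hS hC hg n
    rw [gromovProduct, dist_inv_smul_left, dist_inv_smul_left, smul_smul, ← pow_succ',
      dist_comm _ o] at hprod
    push_cast
    linarith [hS.nonneg o]

theorem gromovProduct_inv_pow_smul_pow_smul_le (hS : FourPoint S δ)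
    (hC : gromovProduct (g⁻¹ • o) (g • o) o ≤ C) (hg : 2 * C + 4 * δ + 1 ≤ dist o (g • o))
    (m n : ℕ) : gromovProduct (g⁻¹ ^ m • o) (g ^ n • o) o ≤ C + 2 * δ := by
  have hδ := hS.nonneg o
  have hC₀ := (gromovProduct_nonneg _ _ _).trans hC
  rcases m with _ | m
  · rw [pow_zero, one_smul, gromovProduct_base_left]
    positivity
  rcases n with _ | n
  · rw [pow_zero, one_smul, gromovProduct_base_right]
    positivity
  exact hS.gromovProduct_le_of_lt_of_lt hC
    (lt_gromovProduct_smul_pow_succ_smul hS (by rwa [inv_inv, gromovProduct_comm])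
      (by rwa [dist_inv_smul_self]) m)
    (lt_gromovProduct_smul_pow_succ_smul hS hC hg n)

theorem exists_isLoxodromic_of_le_dist (hS : FourPoint S δ)
    (hg : 2 * gromovProduct (g⁻¹ • o) (g • o) o + 4 * δ + 1 ≤ dist o (g • o)) :
    ∃ ξ η : GromovBoundary S, IsLoxodromic g ξ η := by
  set C := gromovProduct (g⁻¹ • o) (g • o) o with hC
  have hC' : gromovProduct (g⁻¹⁻¹ • o) (g⁻¹ • o) o = C := by rw [inv_inv, gromovProduct_comm]
  have hg' : 2 * C + 4 * δ + 1 ≤ dist o (g⁻¹ • o) := by rwa [dist_inv_smul_self]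
  have hconv := convergesAtInfinity_pow_smul
    (gromovProduct_inv_pow_smul_pow_smul_le hS hC.ge hg)
    (tendsto_atTop_mono (natCast_le_dist_pow_smul hS hC.ge hg) tendsto_natCast_atTop_atTop)
  have hconv' := convergesAtInfinity_pow_smul
    (gromovProduct_inv_pow_smul_pow_smul_le hS hC'.le hg')
    (tendsto_atTop_mono (natCast_le_dist_pow_smul hS hC'.le hg') tendsto_natCast_atTop_atTop)
  have hξ : ConvergesTo (fun n : ℕ => g ^ n • o) (Quot.mk _ ⟨_, hconv⟩) := ⟨hconv, rfl⟩
  have hη : ConvergesTo (fun n : ℕ => g⁻¹ ^ n • o) (Quot.mk _ ⟨_, hconv'⟩) := ⟨hconv', rfl⟩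
  refine ⟨_, _, fun p => hξ.of_dist_le (D := dist o p) fun n => (dist_smul _ _ _).le,
    fun p => hη.of_dist_le (D := dist o p) fun n => (dist_smul _ _ _).le, fun heq => ?_⟩
  have htop := ((hη.eq_iff_seqEquivalent hS hξ).1 heq.symm).tendsto_diagonal o
  obtain ⟨n, hn⟩ := (htop.eventually_gt_atTop (C + 2 * δ)).exists
  exact hn.not_ge (gromovProduct_inv_pow_smul_pow_smul_le hS hC.ge hg n n)

end LargeDisplacement

namespace IsLoxodromic

theorem conj (hg : IsLoxodromic g ξ η) (a : G) : IsLoxodromic (a * g * a⁻¹) (a • ξ) (a • η) where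
  attracting o := by
    simpa only [conj_pow, mul_smul] using (hg.attracting (a⁻¹ • o)).smul a
  repelling o := by
    simpa only [conj_inv, conj_pow, mul_smul] using (hg.repelling (a⁻¹ • o)).smul a
  ne := (MulAction.injective a).ne hg.ne

theorem exists_gromovProduct_le (hS : FourPoint S δ) (hg : IsLoxodromic g ξ η) (o : S) :
    ∃ C, ∀ m n : ℕ, gromovProduct (g⁻¹ ^ m • o) (g ^ n • o) o ≤ C := by
  obtain ⟨C, hC⟩ := (hg.repelling o).exists_eventually_gromovProduct_le hS (hg.attracting o)
    hg.ne.symm o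
  obtain ⟨⟨M, N⟩, hMN⟩ := eventually_atTop.1 hC
  refine ⟨C + dist o (g ^ N • o) + dist o (g⁻¹ ^ M • o), fun m n => ?_⟩
  have shift : ∀ (a : G) (k l : ℕ), dist (a ^ k • o) (a ^ (k + l) • o) = dist o (a ^ l • o) :=
    fun a k l => by rw [pow_add, mul_smul, dist_smul]
  have hm := gromovProduct_le_add_dist_left (g⁻¹ ^ m • o) (g⁻¹ ^ (m + M) • o) (g ^ n • o) o
  have hn := gromovProduct_le_add_dist_right (g⁻¹ ^ (m + M) • o) (g ^ n • o) (g ^ (n + N) • o) o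
  rw [shift] at hm hn
  linarith [hMN (m + M, n + N) ⟨Nat.le_add_left _ _, Nat.le_add_left _ _⟩]

theorem exists_dist_pow_smul_le (hS : FourPoint S δ) (hg : IsLoxodromic g ξ η) (o : S) :
    ∃ C, ∀ h : G, h • ξ = ξ →
      ∀ n : ℕ, dist (g ^ n • o) (h • g ^ n • o) ≤ 3 * dist o (h • o) + C := by
  obtain ⟨C, hC⟩ := hg.exists_gromovProduct_le hS o
  have hC₀ := (gromovProduct_nonneg _ _ _).trans (hC 0 0)
  have hδ := hS.nonneg o
  refine ⟨2 * C + 4 * δ, fun h hξ n => ?_⟩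
  have hdiag := (((hg.attracting o).eq_iff_seqEquivalent hS
    ((hg.attracting o).smul h)).1 hξ.symm).tendsto_diagonal o
  obtain ⟨N, hN, hnN⟩ := ((hdiag.eventually_ge_atTop (dist o (g ^ n • o))).and
    (eventually_ge_atTop n)).exists
  have hpq := dist_sub_le_gromovProduct_pow_smul hC hnN
  generalize g ^ n • o = p at *
  generalize g ^ N • o = q at *
  have hhpq : gromovProduct p q o ≤ gromovProduct (h • q) (h • p) o + dist o (h • o) := by
    rw [← gromovProduct_smul h, gromovProduct_comm, dist_comm]
    exact gromovProduct_le_add_dist_base _ _ _ _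
  have hphq : dist o p - C - δ ≤ gromovProduct p (h • q) o := by
    linarith [hS.le_gromovProduct_add hpq (z := h • q) (by linarith)]
  have hphp : dist o p - C - dist o (h • o) - 2 * δ ≤ gromovProduct p (h • p) o := by
    have hho := dist_nonneg (x := o) (y := h • o)
    linarith [hS.le_gromovProduct_add (C := dist o p - C - dist o (h • o) - δ)
      (by linarith : _ ≤ gromovProduct p (h • q) o)
      (by linarith : _ ≤ gromovProduct (h • q) (h • p) o)]
  have hhp : dist o (h • p) ≤ dist o (h • o) + dist o p := by
    simpa only [dist_smul] using dist_triangle o (h • o) (h • p)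
  rw [gromovProduct, dist_comm p o, dist_comm _ o] at hphp
  linarith

theorem smul_attracting_eq_of_commute_pow (hS : FourPoint S δ) (hg : IsLoxodromic g ξ η) {k : ℕ}
    (hk : 0 < k) (hcomm : Commute h (g ^ k)) : h • ξ = ξ := by
  obtain ⟨o⟩ := nonempty_of_gromovBoundary ξ
  have hsub := (hg.attracting o).comp (φ := (k * ·)) (tendsto_id.const_mul_atTop' hk)
  refine (hsub.smul h).unique hS (hsub.of_dist_le (D := dist o (h • o)) fun n => ?_)
  simp only [Function.comp_apply]
  rw [pow_mul, smul_smul, (hcomm.pow_right n).eq, mul_smul, dist_smul]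

theorem exists_commute_pow (hS : FourPoint S δ) (hG : IsAcylindricalAction G S)
    (hg : IsLoxodromic g ξ η) (hξ : h • ξ = ξ) : ∃ k, 0 < k ∧ Commute h (g ^ k) := by
  obtain ⟨o⟩ := nonempty_of_gromovBoundary ξ
  obtain ⟨C, hC⟩ := hg.exists_dist_pow_smul_le hS o
  set ε := max 1 (3 * dist o (h • o) + C)
  obtain ⟨R, -, N, -, hN⟩ := hG ε (lt_max_of_lt_left one_pos)
  obtain ⟨M, hM⟩ := (((hg.repelling o).tendsto_dist o).eventually_ge_atTop R).exists
  have hfin := Set.finite_of_encard_le_coe (hN o (g⁻¹ ^ M • o) hM)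
  have hconj : ∀ (n : ℕ) (p : S),
      dist p (((g ^ n)⁻¹ * h * g ^ n) • p) = dist (g ^ n • p) (h • g ^ n • p) := fun n p => by
    rw [mul_assoc, mul_smul, dist_comm, dist_inv_smul_left, dist_comm, mul_smul]
  have hmem : ∀ n ∈ Ici M, (g ^ n)⁻¹ * h * g ^ n ∈ {u : G | dist o (u • o) ≤ ε ∧
      dist (g⁻¹ ^ M • o) (u • g⁻¹ ^ M • o) ≤ ε} := by
    intro n hn
    refine ⟨?_, ?_⟩ <;> rw [hconj]
    · exact (hC h hξ n).trans (le_max_right _ _)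
    · rw [smul_smul, inv_pow, ← pow_sub g hn]
      exact (hC h hξ (n - M)).trans (le_max_right _ _)
  obtain ⟨m, -, n, -, hmn, heq⟩ := (Ici_infinite M).exists_lt_map_eq_of_mapsTo hmem hfin
  refine ⟨n - m, Nat.sub_pos_of_lt hmn, ?_⟩
  rw [pow_sub g hmn.le, Commute, SemiconjBy]
  calc h * (g ^ n * (g ^ m)⁻¹) = g ^ n * ((g ^ n)⁻¹ * h * g ^ n) * (g ^ m)⁻¹ := by group
    _ = g ^ n * (g ^ m)⁻¹ * h := by rw [← heq]; group

theorem smul_attracting_eq_iff (hS : FourPoint S δ) (hG : IsAcylindricalAction G S)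
    (hg : IsLoxodromic g ξ η) : h • ξ = ξ ↔ h • η = η := by
  have forward : ∀ {g : G} {ξ η : GromovBoundary S},
      IsLoxodromic g ξ η → h • ξ = ξ → h • η = η := by
    intro g ξ η hg hξ
    obtain ⟨k, hk, hcomm⟩ := hg.exists_commute_pow hS hG hξ
    refine hg.inv.smul_attracting_eq_of_commute_pow hS hk ?_
    rw [inv_pow]
    exact hcomm.inv_right
  exact ⟨forward hg, forward hg.inv⟩

theorem finite_setOf_smul_attracting_eq_and_smul_eq (hS : FourPoint S δ)
    (hG : IsAcylindricalAction G S) (hg : IsLoxodromic g ξ η) (hζξ : ζ ≠ ξ) (hζη : ζ ≠ η) :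
    {h : G | h • ξ = ξ ∧ h • ζ = ζ}.Finite := by
  obtain ⟨o⟩ := nonempty_of_gromovBoundary ξ
  obtain ⟨K, hK⟩ := exists_dist_smul_le_of_fixed (G := G) hS hg.ne hζη.symm hζξ.symm o
  obtain ⟨C, hC⟩ := hg.exists_dist_pow_smul_le hS o
  set ε := max 1 (max K (3 * K + C))
  obtain ⟨R, -, N, -, hN⟩ := hG ε (lt_max_of_lt_left one_pos)
  obtain ⟨M, hM⟩ := (((hg.attracting o).tendsto_dist o).eventually_ge_atTop R).exists
  refine (Set.finite_of_encard_le_coe (hN o (g ^ M • o) hM)).subset fun h ⟨hξ, hζ⟩ => ?_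
  have ho := hK h hξ ((hg.smul_attracting_eq_iff hS hG).1 hξ) hζ
  have hM := hC h hξ M
  exact ⟨ho.trans ((le_max_left _ _).trans (le_max_right _ _)),
    (by linarith : _ ≤ 3 * K + C).trans ((le_max_right _ _).trans (le_max_right _ _))⟩

end IsLoxodromic

end Loxodromic

section ExistsLoxodromic

variable {G : Type u} [Group G] {S : Type w} [MetricSpace S] [MulAction G S] [IsIsometricSMul G S]
  {δ : ℝ} {o : S} {ξ η ω : GromovBoundary S}

theorem exists_isLoxodromic_of_lt_dist (hS : FourPoint S δ) {a b : G} {B : ℝ}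
    (hab : gromovProduct (a • o) (b • o) o ≤ B) (ha : 2 * B + 12 * δ + 2 < dist o (a • o))
    (hb : 2 * B + 12 * δ + 2 < dist o (b • o)) :
    ∃ (g : G) (ξ η : GromovBoundary S), IsLoxodromic g ξ η := by
  by_contra! hno
  have hδ := hS.nonneg o
  have backtrack : ∀ g : G,
      dist o (g • o) - 4 * δ - 1 ≤ 2 * gromovProduct (g⁻¹ • o) (g • o) o := fun g => by
    by_contra! hlt
    obtain ⟨ξ, η, hg⟩ := exists_isLoxodromic_of_le_dist hS (by linarith : _ ≤ dist o (g • o))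
    exact hno g ξ η hg
  have _ := (gromovProduct_nonneg _ _ _).trans hab
  have haa := backtrack a
  have hbb := backtrack b
  rw [gromovProduct_comm] at haa hbb
  have ha'b : gromovProduct (a⁻¹ • o) (b • o) o ≤ B + δ :=
    hS.gromovProduct_le_of_lt hab (by linarith)
  have hb'a : gromovProduct (b⁻¹ • o) (a • o) o ≤ B + δ :=
    hS.gromovProduct_le_of_lt (by rwa [gromovProduct_comm]) (by linarith)
  have hab_left : gromovProduct (a • o) ((a * b) • o) o =
      dist o (a • o) - gromovProduct (a⁻¹ • o) (b • o) o := gromovProduct_smul_mul_smul a b o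
  have hab_right : gromovProduct (b⁻¹ • o) ((a * b)⁻¹ • o) o =
      dist o (b • o) - gromovProduct (a⁻¹ • o) (b • o) o := by
    rw [mul_inv_rev, gromovProduct_smul_mul_smul, inv_inv, dist_inv_smul_self, gromovProduct_comm]
  have hprod : gromovProduct ((a * b)⁻¹ • o) ((a * b) • o) o ≤ B + δ + 2 * δ :=
    hS.gromovProduct_le_of_lt_of_lt hb'a (by linarith) (by linarith)
  have hdist : dist o ((a * b) • o) =
      dist o (a • o) + dist o (b • o) - 2 * gromovProduct (a⁻¹ • o) (b • o) o := by
    rw [gromovProduct, dist_inv_smul_left, dist_inv_smul_left, mul_smul, dist_comm (b • o)]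
    ring
  linarith [backtrack (a * b)]

theorem exists_isLoxodromic_of_ne (hS : FourPoint S δ) {a b : ℕ → G}
    (ha : ConvergesTo (fun i => a i • o) ξ) (hb : ConvergesTo (fun i => b i • o) η) (hne : ξ ≠ η) :
    ∃ (g : G) (ξ η : GromovBoundary S), IsLoxodromic g ξ η := by
  obtain ⟨B, hB⟩ := ha.exists_eventually_gromovProduct_le hS hb hne o
  obtain ⟨i, hab, hai, hbi⟩ := ((tendsto_atTop_diagonal.eventually hB).and
    (((ha.tendsto_dist o).eventually_gt_atTop (2 * B + 12 * δ + 2)).and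
      ((hb.tendsto_dist o).eventually_gt_atTop (2 * B + 12 * δ + 2)))).exists
  exact exists_isLoxodromic_of_lt_dist hS hab hai hbi

theorem exists_convergesTo_smul_of_mem_limitSet (hξ : ξ ∈ limitSet G S) (o : S) :
    ∃ a : ℕ → G, ConvergesTo (fun i => a i • o) ξ := by
  obtain ⟨s, a, ha⟩ := hξ
  exact ⟨a, ha.of_dist_le fun i => (dist_smul (a i) s o).le⟩

theorem IsLoxodromic.exists_frequently_le_gromovProduct (hS : FourPoint S δ) {f : G}
    (hf : IsLoxodromic f ξ η) (o : S) :
    ∃ C, ∀ a : G, ∃ (g : G) (ξ' η' : GromovBoundary S), IsLoxodromic g ξ' η' ∧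
      ∃ᶠ n : ℕ in atTop, dist o (a • o) - C ≤ gromovProduct (a • o) (a • g ^ n • o) o := by
  obtain ⟨C, hC⟩ := hf.exists_gromovProduct_le hS o
  refine ⟨C + δ, fun a => ?_⟩
  simp only [smul_smul, gromovProduct_smul_mul_smul, sub_le_sub_iff_left]
  have hsplit : ∀ n : ℕ, gromovProduct (a⁻¹ • o) (f⁻¹ ^ n • o) o ≤ C + δ ∨
      gromovProduct (a⁻¹ • o) (f ^ n • o) o ≤ C + δ := fun n => by
    rw [gromovProduct_comm _ (f⁻¹ ^ n • o)]
    exact min_le_iff.1 ((hS _ _ _ _).trans (by linarith [hC n n]))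
  rcases frequently_or_distrib.1 (Frequently.of_forall (f := atTop) hsplit) with h | h
  · exact ⟨f⁻¹, η, ξ, hf.inv, h⟩
  · exact ⟨f, ξ, η, hf, h⟩

theorem ConvergesTo.eventually_smul_attracting_ne (hS : FourPoint S δ) {a : ℕ → G}
    (ha : ConvergesTo (fun i => a i • o) ξ) (hω : ξ ≠ ω) (C : ℝ) :
    ∀ᶠ i in atTop, ∀ (g : G) (ξ' η' : GromovBoundary S), IsLoxodromic g ξ' η' →
      (∃ᶠ n : ℕ in atTop,
        dist o (a i • o) - C ≤ gromovProduct (a i • o) (a i • g ^ n • o) o) → a i • ξ' ≠ ω := by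
  obtain ⟨c, hc⟩ := exists_convergesTo ω
  obtain ⟨B, hB⟩ := ha.exists_eventually_gromovProduct_le hS hc hω o
  filter_upwards [eventually_atTop_curry hB,
    (ha.tendsto_dist o).eventually_gt_atTop (B + δ + C)] with i hBi hai g ξ' η' hg hfreq hfix
  have htop := ((((hg.attracting o).smul (a i)).eq_iff_seqEquivalent hS hc).1 hfix).tendsto_diagonal
    o
  obtain ⟨n, hn, hBn, hlt⟩ :=
    (hfreq.and_eventually (hBi.and (htop.eventually_gt_atTop (B + δ)))).exists
  exact hlt.not_ge (hS.gromovProduct_le_of_lt hBn (by linarith))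

variable (G S) in
/-- The attracting points of the loxodromic elements of `G`. -/
def attractingPoints : Set (GromovBoundary S) :=
  {ξ | ∃ (g : G) (η : GromovBoundary S), IsLoxodromic g ξ η}

theorem IsNonElementaryAction.infinite_attractingPoints (hS : FourPoint S δ)
    (hG : IsNonElementaryAction G S) : (attractingPoints G S).Infinite := by
  intro hfin
  obtain ⟨ξ, hξ, hξA⟩ := (hG.sdiff hfin).nonempty
  obtain ⟨η, hη, hne⟩ := hG.nontrivial.exists_ne ξ
  obtain ⟨o⟩ := nonempty_of_gromovBoundary ξ
  obtain ⟨a, ha⟩ := exists_convergesTo_smul_of_mem_limitSet hξ o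
  obtain ⟨b, hb⟩ := exists_convergesTo_smul_of_mem_limitSet hη o
  obtain ⟨f, ξ₀, η₀, hf⟩ := exists_isLoxodromic_of_ne hS ha hb hne.symm
  obtain ⟨C, hC⟩ := hf.exists_frequently_le_gromovProduct hS o
  obtain ⟨i, hi⟩ := ((eventually_all_finite hfin).2 fun ω hω =>
    ha.eventually_smul_attracting_ne hS (ne_of_mem_of_not_mem hω hξA).symm C).exists
  obtain ⟨g, ξ', η', hg, hfreq⟩ := hC (a i)
  exact hi (a i • ξ') ⟨_, _, hg.conj (a i)⟩ g ξ' η' hg hfreq rfl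

end ExistsLoxodromic

section ConjRecurrent

variable {G : Type u} [Group G]

/-- Conjugating any element of `H` by the powers of any `g` returns it to `H` infinitely often. By
Poincaré recurrence, almost every stabilizer of a finite measure-preserving action of a countable
group has this property. -/
def IsConjRecurrent (H : Subgroup G) : Prop :=
  ∀ h ∈ H, ∀ g : G, ∃ᶠ n : ℕ in atTop, g ^ n * h * (g ^ n)⁻¹ ∈ H

variable {S : Type w} [MetricSpace S] [MulAction G S] {H : Subgroup G}

theorem IsAcylindricalAction.subgroup (hG : IsAcylindricalAction G S) (H : Subgroup G) :
    IsAcylindricalAction H S := by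
  intro ε hε
  obtain ⟨R, hR, N, hN, hRN⟩ := hG ε hε
  refine ⟨R, hR, N, hN, fun x y hxy => le_trans ?_ (hRN x y hxy)⟩
  rw [← Subtype.val_injective.encard_image]
  exact encard_le_encard (image_subset_iff.2 fun g hg => hg)

variable [IsIsometricSMul G S] {δ : ℝ} {g h : G} {ξ η : GromovBoundary S}

/-- `gⁿ o` and `gⁿ h g⁻ⁿ o` fellow-travel, since the product of `g⁻ⁿ o → η` and `h g⁻ⁿ o → h η`
stays bounded. -/
theorem IsLoxodromic.mem_limitSet_of_frequently (hS : FourPoint S δ) (hg : IsLoxodromic g ξ η)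
    (hη : h • η ≠ η) (hrec : ∃ᶠ n : ℕ in atTop, g ^ n * h * (g ^ n)⁻¹ ∈ H) :
    ξ ∈ limitSet H S := by
  obtain ⟨o⟩ := nonempty_of_gromovBoundary ξ
  obtain ⟨C, hC⟩ := (hg.repelling o).exists_eventually_gromovProduct_le hS
    ((hg.repelling o).smul h) hη.symm o
  have hle : ∀ᶠ n : ℕ in atTop, dist o (g ^ n • o) - C ≤
      gromovProduct (g ^ n • o) ((g ^ n * h * (g ^ n)⁻¹) • o) o := by
    filter_upwards [tendsto_atTop_diagonal.eventually hC] with n hn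
    rw [mul_assoc, gromovProduct_smul_mul_smul, mul_smul, ← inv_pow]
    exact sub_le_sub_left hn _
  have htop := tendsto_atTop_mono' atTop hle
    (tendsto_atTop_add_const_right _ (-C) ((hg.attracting o).tendsto_dist o))
  obtain ⟨φ, hφ, hφH⟩ := extraction_of_frequently_atTop hrec
  exact ⟨o, fun n => ⟨_, hφH n⟩, ((hg.attracting o).comp hφ.tendsto_atTop).of_tendsto_gromovProduct
    hS o (htop.comp hφ.tendsto_atTop)⟩

theorem finite_setOf_attractingPoints_fixed (hS : FourPoint S δ) (hG : IsAcylindricalAction G S)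
    [Infinite H] : {ξ ∈ attractingPoints G S | ∀ h ∈ H, h • ξ = ξ}.Finite := by
  rcases eq_empty_or_nonempty {ξ ∈ attractingPoints G S | ∀ h ∈ H, h • ξ = ξ} with
    hempty | ⟨ξ, ⟨g, η, hg⟩, hξ⟩
  · exact hempty ▸ finite_empty
  refine (toFinite {ξ, η}).subset fun ζ ⟨_, hζ⟩ => ?_
  by_contra! hmem
  simp only [mem_insert_iff, mem_singleton_iff, not_or] at hmem
  exact (Set.infinite_coe_iff.1 ‹Infinite H›)
    ((hg.finite_setOf_smul_attracting_eq_and_smul_eq hS hG hmem.1 hmem.2).subset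
      fun h hh => ⟨hξ h hh, hζ h hh⟩)

theorem IsConjRecurrent.isNonElementaryAction (hH : IsConjRecurrent H) [Infinite H]
    (hS : FourPoint S δ) (hG : IsAcylindricalAction G S) (hG' : IsNonElementaryAction G S) :
    IsNonElementaryAction H S := by
  refine ((hG'.infinite_attractingPoints hS).sdiff
    (finite_setOf_attractingPoints_fixed (H := H) hS hG)).mono ?_
  rintro ξ ⟨⟨g, η, hg⟩, hfix⟩
  obtain ⟨h, hh, hξ⟩ : ∃ h ∈ H, h • ξ ≠ ξ := by
    by_contra! hcon
    exact hfix ⟨⟨g, η, hg⟩, hcon⟩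
  exact hg.mem_limitSet_of_frequently hS ((hg.smul_attracting_eq_iff hS hG).not.1 hξ) (hH h hh g)

theorem IsConjRecurrent.isAcylindricallyHyperbolic (hH : IsConjRecurrent H) [Infinite H]
    (hG : IsAcylindricallyHyperbolic.{u, w} G) : IsAcylindricallyHyperbolic.{u, w} H := by
  obtain ⟨S, _, _, _, hS, hacyl, hne⟩ := hG
  obtain ⟨δ, hδ⟩ := hS.exists_fourPoint
  exact ⟨S, inferInstance, inferInstance, ⟨fun h => isometry_smul S (h : G)⟩, hS,
    hacyl.subgroup H, hH.isNonElementaryAction hδ hacyl hne⟩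

end ConjRecurrent

section FiniteNormalSubgroups

variable {G : Type u} [Group G] {s : Set G}

theorem finiteIndex_centralizer_singleton (g : G) (hg : (Group.conjugatesOfSet {g}).Finite) :
    (Subgroup.centralizer {g}).FiniteIndex := by
  have horbit : MulAction.orbit (ConjAct G) g = Group.conjugatesOfSet {g} := by
    ext h
    rw [ConjAct.mem_orbit_conjAct, Group.mem_conjugatesOfSet_iff, isConj_comm]
    simp
  have hindex : (Subgroup.centralizer {g}).index = (Group.conjugatesOfSet {g}).ncard := by
    rw [Subgroup.centralizer_eq_comap_stabilizer, ← horbit, ← MulAction.index_stabilizer]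
    exact Subgroup.index_comap_of_surjective _ ConjAct.toConjAct.surjective
  exact ⟨hindex ▸ ncard_ne_zero_of_mem (Group.subset_conjugatesOfSet rfl) hg⟩

theorem finiteIndex_center_of_closure_eq_top (hs : (Group.conjugatesOfSet s).Finite)
    (htop : Subgroup.closure s = ⊤) : (Subgroup.center G).FiniteIndex := by
  have := (hs.subset Group.subset_conjugatesOfSet).to_subtype
  rw [Subgroup.center_eq_infi' htop]
  exact Subgroup.finiteIndex_iInf fun g => finiteIndex_centralizer_singleton _
    (hs.subset (Group.conjugatesOfSet_mono (singleton_subset_iff.2 g.2)))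

open scoped IsMulCommutative in
/-- The transfer homomorphism to the center is a power map. -/
theorem isMulTorsion_of_closure_eq_top [(Subgroup.center G).FiniteIndex]
    (hs : ∀ t ∈ s, IsOfFinOrder t) (htop : Subgroup.closure s = ⊤) : IsMulTorsion G := by
  have hle : Subgroup.closure s ≤
      (CommGroup.torsion (Subgroup.center G)).comap (MonoidHom.transferCenterPow G) :=
    (Subgroup.closure_le _).2 fun t ht => (MonoidHom.transferCenterPow G).isOfFinOrder (hs t ht)
  intro g
  have hg : IsOfFinOrder (MonoidHom.transferCenterPow G g) := hle (htop ▸ Subgroup.mem_top g)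
  have hpow := (Subgroup.center G).subtype.isOfFinOrder hg
  rw [Subgroup.coe_subtype, MonoidHom.transferCenterPow_apply] at hpow
  exact hpow.of_pow Subgroup.FiniteIndex.index_ne_zero

open scoped IsMulCommutative in
theorem finite_of_closure_eq_top (hs : (Group.conjugatesOfSet s).Finite)
    (hs' : ∀ t ∈ s, IsOfFinOrder t) (htop : Subgroup.closure s = ⊤) : Finite G := by
  have := finiteIndex_center_of_closure_eq_top hs htop
  have hfg : Group.FG G := Group.fg_iff.2 ⟨s, htop, hs.subset Group.subset_conjugatesOfSet⟩
  have : Finite (Subgroup.center G) := CommGroup.finite_of_fg_isMulTorsion _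
    ((isMulTorsion_of_closure_eq_top hs' htop).subgroup _)
  exact Finite.of_subgroup_quotient (Subgroup.center G)

/-- **Dietzmann's lemma**. -/
theorem finite_normalClosure (hs : (Group.conjugatesOfSet s).Finite)
    (hs' : ∀ t ∈ s, IsOfFinOrder t) : Finite (Subgroup.normalClosure s) := by
  let T : Set (Subgroup.normalClosure s) := (↑) ⁻¹' Group.conjugatesOfSet s
  have hT : Group.conjugatesOfSet T ⊆ T := fun _ hx => by
    obtain ⟨t, ht, htx⟩ := Group.mem_conjugatesOfSet_iff.1 hx
    obtain ⟨c, rfl⟩ := isConj_iff.1 htx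
    exact Group.conj_mem_conjugatesOfSet ht
  refine finite_of_closure_eq_top
    ((hs.preimage Subtype.val_injective.injOn).subset hT) (fun t ht => ?_)
    Subgroup.closure_closure_coe_preimage
  obtain ⟨a, ha, hat⟩ := Group.mem_conjugatesOfSet_iff.1 ht
  obtain ⟨c, hc⟩ := isConj_iff.1 hat
  rw [← Submonoid.isOfFinOrder_coe]
  change IsOfFinOrder (t : G)
  rw [← hc]
  exact (MulAut.conj c).toMonoidHom.isOfFinOrder (hs' a ha)

theorem le_finiteRadical_of_finite_conjugates {H : Subgroup G} [Finite H]
    (hH : (range fun g : G => H.map (MulAut.conj g).toMonoidHom).Finite) :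
    H ≤ finiteRadical G := by
  have hconj : Group.conjugatesOfSet (H : Set G) ⊆
      ⋃ K ∈ range fun g : G => H.map (MulAut.conj g).toMonoidHom, (K : Set G) := by
    intro x hx
    obtain ⟨h, hh, hhx⟩ := Group.mem_conjugatesOfSet_iff.1 hx
    obtain ⟨g, rfl⟩ := isConj_iff.1 hhx
    exact mem_biUnion (mem_range_self g) ⟨h, hh, rfl⟩
  have hfin : (Group.conjugatesOfSet (H : Set G)).Finite := by
    refine (hH.biUnion ?_).subset hconj
    rintro _ ⟨g, rfl⟩
    exact (toFinite (H : Set G)).image _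
  have hN : Finite (Subgroup.normalClosure (H : Set G)) :=
    finite_normalClosure hfin fun t ht => H.subtype.isOfFinOrder
      (isOfFinOrder_of_finite (⟨t, ht⟩ : H))
  exact Subgroup.le_normalClosure.trans (le_sSup ⟨Subgroup.normalClosure_normal, hN⟩)

end FiniteNormalSubgroups

section Stabilizers

variable {G : Type u} [Group G] {X : Type v}

theorem countable_setOf_finite_subgroup (G : Type u) [Group G] [Countable G] :
    {K : Subgroup G | Finite K}.Countable :=
  MapsTo.countable_of_injOn (f := fun K : Subgroup G => (K : Set G))
    (t := {s | s.Finite ∧ s ⊆ univ}) (fun _ hK => ⟨finite_coe_iff.1 hK, subset_univ _⟩)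
    SetLike.coe_injective.injOn (countable_ofPred_finite_subset countable_univ)

theorem stabilizer_smul_eq_map_conj_iff [MulAction G X] (g : G) (x : X) (K : Subgroup G) :
    MulAction.stabilizer G (g • x) = K.map (MulAut.conj g).toMonoidHom ↔
      MulAction.stabilizer G x = K := by
  rw [MulAction.stabilizer_smul_eq_stabilizer_map_conj]
  exact (Subgroup.map_injective (MulAut.conj g).injective).eq_iff

theorem finite_stabilizer_smul_iff [MulAction G X] (g : G) (x : X) :
    Finite (MulAction.stabilizer G (g • x)) ↔ Finite (MulAction.stabilizer G x) := by
  rw [MulAction.stabilizer_smul_eq_stabilizer_map_conj]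
  exact ((MulAction.stabilizer G x).equivMapOfInjective _
    (MulAut.conj g).injective).toEquiv.finite_iff.symm

variable [MeasurableSpace X] [MeasurableEq X] [MulAction G X] [MeasurableConstSMul G X]

theorem measurableSet_fixedBy (g : G) : MeasurableSet (MulAction.fixedBy X g) :=
  measurableSet_eq_fun (measurable_const_smul g) measurable_id

variable [Countable G]

theorem measurableSet_stabilizer_eq (K : Subgroup G) :
    MeasurableSet {x : X | MulAction.stabilizer G x = K} := by
  simp only [Subgroup.ext_iff, ofPred_forall]
  exact .iInter fun g => (measurableSet_fixedBy g).iff (.const _)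

theorem measurableSet_finite_stabilizer :
    MeasurableSet {x : X | Finite (MulAction.stabilizer G x)} := by
  have heq : {x : X | Finite (MulAction.stabilizer G x)} =
      ⋃ K ∈ {K : Subgroup G | Finite K}, {x : X | MulAction.stabilizer G x = K} := by
    ext x
    simp
  rw [heq]
  exact .biUnion (countable_setOf_finite_subgroup G) fun K _ => measurableSet_stabilizer_eq K

variable (ν : Measure X)

theorem ae_finite_or_ae_infinite_stabilizer [ErgodicSMul G X ν] :
    (∀ᵐ x ∂ν, Finite (MulAction.stabilizer G x)) ∨
      ∀ᵐ x ∂ν, Infinite (MulAction.stabilizer G x) := by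
  simp only [← not_finite_iff_infinite]
  exact eventuallyConst_set.1 (aeconst_of_forall_preimage_smul_ae_eq G
    measurableSet_finite_stabilizer.nullMeasurableSet fun g =>
      .of_eq (Set.ext (finite_stabilizer_smul_iff g)))

variable [IsFiniteMeasure ν] [SMulInvariantMeasure G X ν]

theorem ae_isConjRecurrent_stabilizer :
    ∀ᵐ x ∂ν, IsConjRecurrent (MulAction.stabilizer G x) := by
  have hrec : ∀ h g : G, ∀ᵐ x ∂ν, h • x = x → ∃ᶠ n : ℕ in atTop,
      g ^ n * h * (g ^ n)⁻¹ ∈ MulAction.stabilizer G x := by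
    intro h g
    filter_upwards [(measurePreserving_smul g⁻¹ ν).conservative.ae_mem_imp_frequently_image_mem
      (measurableSet_fixedBy h).nullMeasurableSet] with x hx hfix
    refine (hx hfix).mono fun n hn => ?_
    rw [smul_iterate, inv_pow, MulAction.mem_fixedBy] at hn
    rw [MulAction.mem_stabilizer_iff, mul_smul, mul_smul, hn, smul_inv_smul]
  filter_upwards [ae_all_iff.2 fun h => ae_all_iff.2 (hrec h)] with x hx h hh g
  exact hx h g hh

/-- The sets of points with a given conjugate of `F` as stabilizer are pairwise disjoint and have
the same measure. -/
theorem finite_conjugates_of_measure_stabilizer_eq_ne_zero {F : Subgroup G}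
    (hF : ν {x : X | MulAction.stabilizer G x = F} ≠ 0) :
    (range fun g : G => F.map (MulAut.conj g).toMonoidHom).Finite := by
  refine (Measure.finite_const_le_meas_of_disjoint_iUnion ν (pos_iff_ne_zero.2 hF)
    measurableSet_stabilizer_eq
    (fun K L hKL => disjoint_left.2 fun x hK hL => hKL (hK.symm.trans hL))
    (measure_ne_top _ _)).subset ?_
  rintro _ ⟨g, rfl⟩
  rw [mem_ofPred_eq, ← measure_preimage_smul ν g {x | _ = F.map _}]
  refine (congrArg ν ?_).le
  ext x
  exact (stabilizer_smul_eq_map_conj_iff g x F).symm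

theorem ae_stabilizer_le_finiteRadical_of_finite :
    ∀ᵐ x ∂ν, Finite (MulAction.stabilizer G x) → MulAction.stabilizer G x ≤ finiteRadical G := by
  have hle : ∀ᵐ x ∂ν, ∀ F ∈ {F : Subgroup G | Finite F},
      MulAction.stabilizer G x = F → F ≤ finiteRadical G := by
    refine (ae_ball_iff (countable_setOf_finite_subgroup G)).2 fun F hF => ?_
    have : Finite F := hF
    by_cases hν : ν {x : X | MulAction.stabilizer G x = F} = 0
    · filter_upwards [measure_eq_zero_iff_ae_notMem.1 hν] with x hx hxF using absurd hxF hx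
    · exact .of_forall fun _ _ => le_finiteRadical_of_finite_conjugates
        (finite_conjugates_of_measure_stabilizer_eq_ne_zero ν hν)
  filter_upwards [hle] with x hx hfin using hx _ hfin rfl

end Stabilizers

end AcylHyp

theorem mainTheorem5_general (G : Type u) [Group G] [Countable G]
    (hG : AcylHyp.IsAcylindricallyHyperbolic.{u, w} G)
    (X : Type v) [MeasurableSpace X] [MeasurableEq X]
    (ν : Measure X) [IsFiniteMeasure ν]
    [MulAction G X] [MeasurableConstSMul G X] [ErgodicSMul G X ν] :
    ((∀ᵐ x ∂ν, AcylHyp.IsAcylindricallyHyperbolic.{u, w} (MulAction.stabilizer G x)) ∨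
      (∀ᵐ x ∂ν, Finite (MulAction.stabilizer G x))) ∧
    ∀ᵐ x ∂ν, Finite (MulAction.stabilizer G x) →
      MulAction.stabilizer G x ≤ AcylHyp.finiteRadical G := by
  refine ⟨?_, AcylHyp.ae_stabilizer_le_finiteRadical_of_finite ν⟩
  rcases AcylHyp.ae_finite_or_ae_infinite_stabilizer (G := G) ν with hfin | hinf
  · exact .inr hfin
  · left
    filter_upwards [hinf, AcylHyp.ae_isConjRecurrent_stabilizer (G := G) ν] with x hx hrec
    exact hrec.isAcylindricallyHyperbolic hG

theorem mainTheorem5 (G : Type u) [Group G] [Countable G]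
    (hG : AcylHyp.IsAcylindricallyHyperbolic.{u, w} G)
    (X : Type v) [MeasurableSpace X] [StandardBorelSpace X]
    (ν : Measure X) [IsProbabilityMeasure ν]
    [MulAction G X] [MeasurableConstSMul G X] [ErgodicSMul G X ν] :
    ((∀ᵐ x ∂ν, AcylHyp.IsAcylindricallyHyperbolic.{u, w} (MulAction.stabilizer G x)) ∨
      (∀ᵐ x ∂ν, Finite (MulAction.stabilizer G x))) ∧
    (AcylHyp.finiteRadical G = ⊥ →
      (∀ᵐ x ∂ν, Finite (MulAction.stabilizer G x)) →
        AcylHyp.IsEssentiallyFree G ν) := by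
  obtain ⟨hdich, hle⟩ := mainTheorem5_general G hG X ν
  exact ⟨hdich, fun hrad hfin => hfin.mp (hle.mono fun _ hx hx' => le_bot_iff.1 (hrad ▸ hx hx'))⟩
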